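/- Let $G$ be a finite group and let $p$ be a prime such that $|G : C(x)| = p^2$ for every $x \in G \setminus Z(G)$, where $C(x)$ is the centralizer of $x$ in $G$ and $Z(G)$ is the center of $G$. Let $\mathrm{Cent}(G) = \{C(x) : x \in G\}$ be the set of centralizers of single elements of $G$. Then one of the following holds: (a) $G/Z(G)$ is an elementary abelian $p$-group (possibly trivial, which happens exactly when $G$ is abelian); (b) $p$ is odd, $G/Z(G)$ is non-abelian of order $p^3$ and exponent $p$, and $|\mathrm{Cent}(G)| = p^2 + p + 2$. -/

import Mathlib

/-- An elementary abelian `p`-group: an abelian group in which `x ^ p = 1` for all `x`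
(the trivial group is allowed). -/
def IsElementaryAbelian (p : ℕ) (H : Type*) [Group H] : Prop :=
  (∀ x y : H, x * y = y * x) ∧ ∀ x : H, x ^ p = 1

/-- `Cent(G)`: the set of centralizers of single elements of `G`
(it contains `G` itself, the centralizer of `1`). -/
def elementCentralizers (G : Type*) [Group G] : Set (Subgroup G) :=
  Set.range fun x : G => Subgroup.centralizer {x}

/-! Write `Z` and `U` for the center and second center, `M(y)` for `centralizerModCenter y` and
`J(y)` for `centralCommutators y`. The map `g ↦ ⁅g, y⁆` on `M(y)` has kernel `C(y)` and image
`J(y)`, so `|J(y)| * |G : M(y)| = p ^ 2` for noncentral `y`.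

If `G/Z` is abelian, then `M(y) = G`; a noncentral `x ^ p` would have the same centralizer as `x`,
contradicting the existence of a commutator `⁅g, x⁆` of order `p`.

Otherwise `G/Z` is a nontrivial `p`-group, so `U` exceeds `Z`. When `y ∉ U` fails to centralize `U`,
both factors above equal `p`, which forces `G' ≤ U`. A noncentral `w ∈ G'` then has the largest
centralizer among noncentral elements of `U`, whence `|U/Z| = p`. The three subgroups lemma gives `U
= C(w)`, of index `p ^ 2`, so `|G/Z| = p ^ 3`. Each noncentral `C(x)/Z` now has order `p`, and these
subgroups partition `G/Z`; exponent and count follow. -/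

/-! ### Class sizes and the central quotient -/

/-- A finite group is not the union of the conjugates of a proper subgroup. -/
theorem Subgroup.eq_top_of_forall_exists_conj_mem {G : Type*} [Group G] [Finite G]
    (H : Subgroup G) (hH : ∀ x : G, ∃ g : G, g⁻¹ * x * g ∈ H) : H = ⊤ := by
  classical
  have := Fintype.ofFinite G
  have := Fintype.ofFinite (G ⧸ H)
  have := Fintype.ofFinite (Quotient (MulAction.orbitRel G (G ⧸ H)))
  by_contra hne
  have hcard : 1 < Fintype.card (G ⧸ H) := by
    rw [← Nat.card_eq_fintype_card]
    exact Subgroup.one_lt_index_of_ne_top hne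
  have burnside := MulAction.sum_card_fixedBy_eq_card_orbits_mul_card_group G (G ⧸ H)
  have orbits : Fintype.card (Quotient (MulAction.orbitRel G (G ⧸ H))) = 1 := by
    have h := (MulAction.pretransitive_iff_subsingleton_quotient G (G ⧸ H)).1 inferInstance
    exact Fintype.card_eq_one_iff_nonempty_unique.2 ⟨⟨⟨Quotient.mk'' (QuotientGroup.mk 1)⟩,
      fun _ => Subsingleton.elim _ _⟩⟩
  -- Every element fixes a coset and the identity fixes several, so the average exceeds the single
  -- orbit.
  have hlt : ∑ _g : G, 1 < ∑ g : G, Fintype.card (MulAction.fixedBy (G ⧸ H) g) := by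
    refine Finset.sum_lt_sum (fun x _ => ?_) ⟨1, Finset.mem_univ _, ?_⟩
    · obtain ⟨g, hg⟩ := hH x
      refine Fintype.card_pos_iff.2 ⟨⟨(g : G ⧸ H), ?_⟩⟩
      rw [MulAction.mem_fixedBy, MulAction.Quotient.smul_coe, eq_comm, QuotientGroup.eq]
      simpa [mul_assoc] using hg
    · rw [← set_fintype_card_eq_univ_iff _ |>.2 (MulAction.fixedBy_one_eq_univ (G ⧸ H) G)] at hcard
      exact hcard
  rw [burnside, orbits] at hlt
  simp at hlt

/-- If every conjugacy class has size `1` or `p ^ n`, then the central quotient is a `p`-group. -/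
theorem isPGroup_quotient_center_of_index_centralizer {G : Type*} [Group G] [Finite G]
    {p n : ℕ} (hp : p.Prime)
    (hG : ∀ x : G, x ∉ Subgroup.center G → (Subgroup.centralizer {x}).index = p ^ n) :
    IsPGroup p (G ⧸ Subgroup.center G) := by
  rw [isPGroup_iff_primeFactors_card_subset hp.ne_zero, hp.primeFactors]
  intro q hq
  rw [Finset.mem_singleton]
  by_contra hqp
  have hq' := Nat.prime_of_mem_primeFactors hq
  have := Fact.mk hq'
  obtain ⟨Q⟩ : Nonempty (Sylow q G) := inferInstance
  have key : (Q : Subgroup G) ≤ Subgroup.center G := by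
    intro y hy
    have htop : Subgroup.centralizer {y} = ⊤ := by
      refine Subgroup.eq_top_of_forall_exists_conj_mem _ fun x => ?_
      have hnd : ¬ q ∣ Nat.card (G ⧸ Subgroup.centralizer {x}) := by
        change ¬ q ∣ (Subgroup.centralizer {x}).index
        by_cases hx : x ∈ Subgroup.center G
        · have : Subgroup.centralizer {x} = ⊤ := by
            rw [Subgroup.centralizer_eq_top_iff_subset]; simpa using hx
          rw [this, Subgroup.index_top]
          exact hq'.not_dvd_one
        · rw [hG x hx]
          intro h
          exact hqp ((Nat.prime_dvd_prime_iff_eq hq' hp).1 (hq'.dvd_of_dvd_pow h))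
      -- A coset of `C(x)` fixed by `Q` yields a conjugate of `x` commuting with `y`; thus `C(y)`
      -- meets every class.
      obtain ⟨a, ha⟩ := Q.isPGroup'.nonempty_fixed_point_of_prime_not_dvd_card _ hnd
      induction a using QuotientGroup.induction_on with
      | H g =>
        have h : ((y * g : G) : G ⧸ Subgroup.centralizer {x}) = g := ha ⟨y, hy⟩
        rw [eq_comm, QuotientGroup.eq, Subgroup.mem_centralizer_singleton_iff] at h
        refine ⟨g⁻¹, ?_⟩
        rw [Subgroup.mem_centralizer_singleton_iff]
        have h2 := congrArg (fun z => g * z * g⁻¹) h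
        simp only [mul_assoc, inv_inv, mul_inv_cancel_left, mul_inv_cancel, mul_one] at h2 ⊢
        simpa using h2.symm
    rw [Subgroup.centralizer_eq_top_iff_subset] at htop
    simpa using htop
  exact Q.not_dvd_index ((Nat.dvd_of_mem_primeFactors hq).trans (Subgroup.index_dvd_of_le key))

/-! ### Commutators with central values -/

open scoped commutatorElement

/-- The second term of the upper central series. -/
def Subgroup.secondCenter (G : Type*) [Group G] : Subgroup G :=
  (center (G ⧸ center G)).comap (QuotientGroup.mk' _)

/-- The elements that commute with `y` modulo the center. -/
def Subgroup.centralizerModCenter {G : Type*} [Group G] (y : G) : Subgroup G :=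
  (centralizer {(y : G ⧸ center G)}).comap (QuotientGroup.mk' _)

namespace Subgroup

theorem mem_centralizer_singleton_iff_commutatorElement {G : Type*} [Group G] {g x : G} :
    g ∈ centralizer {x} ↔ ⁅g, x⁆ = 1 := by
  rw [mem_centralizer_singleton_iff, commutatorElement_eq_one_iff_mul_comm]

theorem mem_centralizer_singleton_comm {G : Type*} [Group G] {g x : G} :
    g ∈ centralizer {x} ↔ x ∈ centralizer {g} := by
  rw [mem_centralizer_singleton_iff, mem_centralizer_singleton_iff, eq_comm]

theorem centralizer_singleton_eq_top_iff {G : Type*} [Group G] {x : G} :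
    centralizer {x} = ⊤ ↔ x ∈ center G := by
  rw [centralizer_eq_top_iff_subset, Set.singleton_subset_iff, SetLike.mem_coe]

theorem mem_centralizerModCenter {G : Type*} [Group G] {g y : G} :
    g ∈ centralizerModCenter y ↔ ⁅g, y⁆ ∈ center G := by
  rw [centralizerModCenter, mem_comap, mem_centralizer_singleton_iff_commutatorElement,
    ← QuotientGroup.eq_one_iff]
  rfl

theorem mem_centralizerModCenter_comm {G : Type*} [Group G] {g y : G} :
    g ∈ centralizerModCenter y ↔ y ∈ centralizerModCenter g := by
  rw [mem_centralizerModCenter, mem_centralizerModCenter, ← commutatorElement_inv, inv_mem_iff]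

theorem mem_secondCenter {G : Type*} [Group G] {x : G} :
    x ∈ secondCenter G ↔ ∀ g : G, g ∈ centralizerModCenter x := by
  rw [secondCenter, mem_comap, mem_center_iff]
  constructor
  · intro h g
    exact mem_centralizer_singleton_iff.2 (h g)
  · intro h g
    induction g using QuotientGroup.induction_on with
    | H g => exact mem_centralizer_singleton_iff.1 (h g)

theorem centralizerModCenter_eq_top_iff {G : Type*} [Group G] {x : G} :
    centralizerModCenter x = ⊤ ↔ x ∈ secondCenter G := by
  rw [mem_secondCenter, eq_top_iff']

theorem center_le_secondCenter (G : Type*) [Group G] : center G ≤ secondCenter G := by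
  intro x hx
  rw [mem_secondCenter]
  intro g
  rw [mem_centralizerModCenter, commutatorElement_eq_one_iff_mul_comm.2 (mem_center_iff.1 hx g)]
  exact one_mem _

theorem centralizer_le_centralizerModCenter {G : Type*} [Group G] (y : G) :
    centralizer {y} ≤ centralizerModCenter y := by
  intro g hg
  rw [mem_centralizerModCenter, mem_centralizer_singleton_iff_commutatorElement.1 hg]
  exact one_mem _

/-- `g ↦ ⁅g, y⁆` is a homomorphism on the elements that commute with `y` modulo the center. -/
def commutatorHom {G : Type*} [Group G] (y : G) : centralizerModCenter y →* G where
  toFun g := ⁅(g : G), y⁆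
  map_one' := commutatorElement_one_left y
  map_mul' g h := by
    have hh := mem_center_iff.1 (mem_centralizerModCenter.1 h.2) g
    have hg := mem_center_iff.1 (mem_centralizerModCenter.1 h.2) ⁅(g : G), y⁆
    rw [coe_mul, commutatorElement_mul_left_eq_conj_mul, hh, mul_inv_cancel_right, hg]

/-- The central commutators of the form `⁅g, y⁆`. -/
def centralCommutators {G : Type*} [Group G] (y : G) : Subgroup G :=
  (commutatorHom y).range

theorem mem_centralCommutators {G : Type*} [Group G] {y z : G} :
    z ∈ centralCommutators y ↔ z ∈ center G ∧ ∃ g : G, ⁅g, y⁆ = z := by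
  constructor
  · rintro ⟨g, rfl⟩
    exact ⟨mem_centralizerModCenter.1 g.2, g, rfl⟩
  · rintro ⟨hz, g, rfl⟩
    exact ⟨⟨g, mem_centralizerModCenter.2 hz⟩, rfl⟩

theorem centralCommutators_le_center {G : Type*} [Group G] (y : G) :
    centralCommutators y ≤ center G := fun _ h => (mem_centralCommutators.1 h).1

theorem card_centralCommutators {G : Type*} [Group G] (y : G) :
    Nat.card (centralCommutators y) = (centralizer {y}).relIndex (centralizerModCenter y) := by
  rw [centralCommutators, ← index_ker, relIndex]
  congr 1
  ext g
  rw [MonoidHom.mem_ker, mem_subgroupOf, mem_centralizer_singleton_iff_commutatorElement]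
  rfl

theorem card_centralCommutators_mul_index {G : Type*} [Group G] (y : G) :
    Nat.card (centralCommutators y) * (centralizerModCenter y).index = (centralizer {y}).index := by
  rw [card_centralCommutators, relIndex_mul_index (centralizer_le_centralizerModCenter y)]

/-- Here `commutatorHom x` is defined on all of `G` with central values, so it kills commutators. -/
theorem commutator_le_centralizer_of_mem_secondCenter {G : Type*} [Group G] {x : G}
    (hx : x ∈ secondCenter G) : _root_.commutator G ≤ centralizer {x} := by
  rw [_root_.commutator_def, commutator_le]
  intro g _ h _
  rw [mem_centralizer_singleton_iff_commutatorElement]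
  rw [mem_secondCenter] at hx
  have hcomm : Commute (commutatorHom x ⟨g, hx g⟩) (commutatorHom x ⟨h, hx h⟩) :=
    (mem_center_iff.1 (mem_centralizerModCenter.1 (hx h)) _)
  have := map_commutatorElement (commutatorHom x) ⟨g, hx g⟩ ⟨h, hx h⟩
  rw [hcomm.commutator_eq] at this
  exact this

/-- A subgroup that contains the complement of a proper subgroup is everything. -/
theorem eq_top_of_forall_notMem {G : Type*} [Group G] {H K : Subgroup G} (hH : H ≠ ⊤)
    (hK : ∀ g, g ∉ H → g ∈ K) : K = ⊤ := by
  obtain ⟨a, ha⟩ : ∃ a, a ∉ H := by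
    by_contra! h
    exact hH ((eq_top_iff' H).2 h)
  rw [eq_top_iff']
  intro g
  by_cases hg : g ∈ H
  · have h : a * g ∉ H := fun h => ha ((mul_mem_cancel_right hg).1 h)
    exact (mul_mem_cancel_left (hK a ha)).1 (hK _ h)
  · exact hK g hg

theorem eq_of_card_eq_prime_of_mem {G : Type*} [Group G] {p : ℕ} (hp : p.Prime)
    {H K : Subgroup G} (hH : Nat.card H = p) (hK : Nat.card K = p) {z : G} (hzH : z ∈ H)
    (hzK : z ∈ K) (hz : z ≠ 1) : H = K := by
  have hne : zpowers z ≠ ⊥ := zpowers_ne_bot.2 hz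
  have key : ∀ L : Subgroup G, Nat.card L = p → z ∈ L → zpowers z = L := by
    intro L hL hzL
    have : Finite L := Nat.finite_of_card_ne_zero (hL ▸ hp.ne_zero)
    have hle : zpowers z ≤ L := zpowers_le.2 hzL
    refine eq_of_le_of_card_ge hle ?_
    rcases (Nat.dvd_prime hp).1 (hL ▸ card_dvd_of_le hle) with h | h
    · exact absurd (card_eq_one.1 h) hne
    · rw [h, hL]
  rw [← key H hH hzH, key K hK hzK]

end Subgroup

/-- The index is the least prime factor of the order, so `H` is normal with cyclic quotient. -/
theorem IsPGroup.commutator_le_of_index_eq {G : Type*} [Group G] [Finite G] {p : ℕ}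
    [Fact p.Prime] (hG : IsPGroup p G) {H : Subgroup G} (hH : H.index = p) :
    commutator G ≤ H := by
  have hp : p.Prime := Fact.out
  obtain ⟨n, hn⟩ := IsPGroup.iff_card.1 hG
  have hn0 : n ≠ 0 := by
    rintro rfl
    rw [pow_zero] at hn
    have := H.index_dvd_card
    rw [hn, hH] at this
    exact hp.not_dvd_one this
  have : H.Normal := Subgroup.normal_of_index_eq_minFac_card (by
    rw [hH, hn, hp.pow_minFac hn0])
  have : IsCyclic (G ⧸ H) := isCyclic_of_prime_card (p := p) hH
  exact Subgroup.Normal.quotient_commutative_iff_commutator_le.1 inferInstance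

/-! ### Non-abelian central quotient -/

namespace Subgroup

theorem card_centralCommutators_of_mem_secondCenter {G : Type*} [Group G] {y : G}
    (hy : y ∈ secondCenter G) : Nat.card (centralCommutators y) = (centralizer {y}).index := by
  rw [← card_centralCommutators_mul_index, centralizerModCenter_eq_top_iff.2 hy, index_top, mul_one]

/-- If `y` lies outside the second center but does not centralize it, and the class of `y` has
`p ^ 2` elements, then there are `p` central commutators `⁅g, y⁆`. -/
theorem card_centralCommutators_eq_prime {G : Type*} [Group G] {p : ℕ} (hp : p.Prime) {x y : G}
    (hC : (centralizer {y}).index = p ^ 2) (hy : y ∉ secondCenter G)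
    (hx : x ∈ secondCenter G) (hxy : y ∉ centralizer {x}) :
    Nat.card (centralCommutators y) = p ∧ (centralizerModCenter y).index = p := by
  have h := card_centralCommutators_mul_index y
  rw [hC] at h
  refine (hp.mul_eq_prime_sq_iff ?_ ?_).1 h
  · intro h1
    rw [card_eq_one] at h1
    have hmem : ⁅x, y⁆ ∈ centralCommutators y :=
      mem_centralCommutators.2 ⟨mem_centralizerModCenter.1
        (mem_centralizerModCenter_comm.1 (mem_secondCenter.1 hx y)), x, rfl⟩
    rw [h1, mem_bot, ← mem_centralizer_singleton_iff_commutatorElement] at hmem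
    exact hxy (mem_centralizer_singleton_comm.1 hmem)
  · rw [Ne, index_eq_one, centralizerModCenter_eq_top_iff]
    exact hy

theorem index_centralizerModCenter {G : Type*} [Group G] (y : G) :
    (centralizerModCenter y).index = (centralizer {(y : G ⧸ center G)}).index :=
  index_comap_of_surjective _ (QuotientGroup.mk'_surjective _)

theorem commutator_le_centralizerModCenter {G : Type*} [Group G] [Finite G] {p : ℕ}
    [Fact p.Prime] (hP : IsPGroup p (G ⧸ center G)) {y : G}
    (hy : (centralizerModCenter y).index = p) : _root_.commutator G ≤ centralizerModCenter y := by
  have h := hP.commutator_le_of_index_eq ((index_centralizerModCenter y).symm.trans hy)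
  rw [_root_.commutator_def, commutator_le]
  intro g _ k _
  rw [centralizerModCenter, mem_comap, map_commutatorElement]
  exact h (commutator_mem_commutator (mem_top _) (mem_top _))

/-- If all noncentral classes have `p ^ 2` elements then `G` has nilpotency class at most `3`. -/
theorem commutator_le_secondCenter {G : Type*} [Group G] [Finite G] {p : ℕ}
    [hp : Fact p.Prime] (hP : IsPGroup p (G ⧸ center G))
    (hG : ∀ x : G, x ∉ center G → (centralizer {x}).index = p ^ 2)
    {x : G} (hx : x ∈ secondCenter G) (hxc : x ∉ center G) :
    _root_.commutator G ≤ secondCenter G := by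
  intro z hz
  rw [← centralizerModCenter_eq_top_iff]
  -- It is enough to treat `y` outside the proper subgroup `C(x)`.
  refine eq_top_of_forall_notMem (mt centralizer_singleton_eq_top_iff.1 hxc) fun y hy => ?_
  rw [mem_centralizerModCenter_comm]
  by_cases hyU : y ∈ secondCenter G
  · exact mem_secondCenter.1 hyU z
  · have hyc : y ∉ center G := fun h => hyU (center_le_secondCenter G h)
    exact commutator_le_centralizerModCenter hP
      (card_centralCommutators_eq_prime hp.out (hG y hyc) hyU hx hy).2 hz

/-- A noncentral commutator element has the largest centralizer among the noncentral elements of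
the second center. -/
theorem centralizer_le_centralizer_of_mem_secondCenter {G : Type*} [Group G] {p : ℕ}
    (hp : p.Prime) (hG : ∀ x : G, x ∉ center G → (centralizer {x}).index = p ^ 2)
    (hU : _root_.commutator G ≤ secondCenter G) {w x : G} (hw : w ∈ _root_.commutator G)
    (hwc : w ∉ center G) (hx : x ∈ secondCenter G) (hxc : x ∉ center G) :
    centralizer {x} ≤ centralizer {w} := by
  intro y hyx
  by_contra hyw
  have notU : ∀ h : G, h ∉ centralizer {w} → h ∉ secondCenter G := fun h hh hhU =>
    hh (mem_centralizer_singleton_comm.1 (commutator_le_centralizer_of_mem_secondCenter hhU hw))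
  have card : ∀ h : G, h ∉ centralizer {w} → Nat.card (centralCommutators h) = p := fun h hh =>
    (card_centralCommutators_eq_prime hp
      (hG h fun hc => notU h hh (center_le_secondCenter G hc)) (notU h hh) (hU hw) hh).1
  have mem : ∀ u ∈ secondCenter G, ∀ h : G, ⁅u, h⁆ ∈ centralCommutators h := fun u hu h =>
    mem_centralCommutators.2 ⟨mem_centralizerModCenter.1
      (mem_centralizerModCenter_comm.1 (mem_secondCenter.1 hu h)), u, rfl⟩
  have one : ∀ h : G, ⁅w, h⁆ = 1 ↔ h ∈ centralizer {w} := fun h => by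
    rw [mem_centralizer_singleton_comm, mem_centralizer_singleton_iff_commutatorElement]
  have hmul : ∀ u ∈ secondCenter G, ∀ g h : G, ⁅u, g * h⁆ = ⁅u, g⁆ * ⁅u, h⁆ := fun u hu g h => by
    rw [commutatorElement_mul_right_eq_mul_conj, mul_assoc, mul_assoc,
      ← mem_center_iff.1 (centralCommutators_le_center h (mem u hu h)) g⁻¹, mul_inv_cancel_left]
  have hwU := hU hw
  -- `B` consists of the `g` with `⁅w, g⁆ ∈ J(y)`. It is proper since `|J(w)| = p ^ 2 > |J(y)|`; the
  -- aim is that `x` commutes with everything outside it.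
  let B : Subgroup G := (centralCommutators y).comap ((commutatorHom w).comp
    ((MonoidHom.id G).codRestrict (centralizerModCenter w) (mem_secondCenter.1 hwU)))
  have hB : ∀ g, g ∈ B ↔ ⁅w, g⁆ ∈ centralCommutators y := fun g => by
    rw [← commutatorElement_inv g w, inv_mem_iff]
    exact Iff.rfl
  have hBtop : B ≠ ⊤ := by
    intro h
    have hle : centralCommutators w ≤ centralCommutators y := by
      intro z hz
      obtain ⟨-, g, rfl⟩ := mem_centralCommutators.1 hz
      rw [← inv_mem_iff, commutatorElement_inv, ← hB, h]
      exact mem_top g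
    have hfin : Finite (centralCommutators y) :=
      Nat.finite_of_card_ne_zero (card y hyw ▸ hp.ne_zero)
    have hcard := Nat.card_mono (Set.toFinite _) hle
    change Nat.card (centralCommutators w) ≤ Nat.card (centralCommutators y) at hcard
    rw [card_centralCommutators_of_mem_secondCenter hwU, hG w hwc, card y hyw] at hcard
    nlinarith [hp.two_le]
  refine mt centralizer_singleton_eq_top_iff.1 hxc (eq_top_of_forall_notMem hBtop fun g hg => ?_)
  rw [mem_centralizer_singleton_comm, mem_centralizer_singleton_iff_commutatorElement]
  by_contra hxg
  rw [hB] at hg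
  have hgw : g ∉ centralizer {w} := fun h => hg ((one g).2 h ▸ one_mem _)
  have hygw : y * g ∉ centralizer {w} := fun h => hg <| by
    have := (one _).2 h
    rw [hmul w hwU, mul_eq_one_iff_inv_eq] at this
    exact this ▸ inv_mem (mem w hwU y)
  have hxy : ⁅x, y⁆ = 1 := by
    rwa [← mem_centralizer_singleton_iff_commutatorElement, ← mem_centralizer_singleton_comm]
  have hxyg : ⁅x, y * g⁆ = ⁅x, g⁆ := by rw [hmul x hx, hxy, one_mul]
  -- Subgroups of order `p` sharing a nontrivial element coincide: `⁅x, g⁆` links `J(y * g)` to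
  -- `J(g)`, and then `⁅w, y⁆` links `J(g)` to `J(y)`.
  have hJ : centralCommutators (y * g) = centralCommutators g :=
    eq_of_card_eq_prime_of_mem hp (card _ hygw) (card _ hgw) (hxyg ▸ mem x hx (y * g))
      (mem x hx g) hxg
  have hwy : ⁅w, y⁆ ∈ centralCommutators g := by
    have := mem w hwU (y * g)
    rw [hJ, hmul w hwU] at this
    exact (mul_mem_cancel_right (mem w hwU g)).1 this
  have hJ' : centralCommutators g = centralCommutators y :=
    eq_of_card_eq_prime_of_mem hp (card _ hgw) (card _ hyw) hwy (mem w hwU y)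
      (mt (one y).1 hyw)
  exact hg (hJ' ▸ mem w hwU g)

/-- Three subgroups lemma for `⟨c⟩`, `M(c)` and `G`. -/
theorem centralizerModCenter_le_centralizer_commutatorElement {G : Type*} [Group G] {b c : G}
    (hc : c ∈ centralizer (_root_.commutator G : Set G)) :
    centralizerModCenter c ≤ centralizer {⁅b, c⁆} := by
  have h1 : ⁅⁅zpowers c, centralizerModCenter c⁆, (⊤ : Subgroup G)⁆ = ⊥ := by
    rw [commutator_eq_bot_iff_le_centralizer, coe_top, centralizer_univ, commutator_le]
    intro x hx g hg
    rw [mem_zpowers_iff] at hx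
    obtain ⟨k, rfl⟩ := hx
    have hcomm : Commute (c : G ⧸ center G) (g : G ⧸ center G) :=
      (mem_centralizer_singleton_iff.1 hg).symm
    rw [← QuotientGroup.eq_one_iff]
    exact (hcomm.zpow_left k).commutator_eq
  have h2 : ⁅⁅centralizerModCenter c, (⊤ : Subgroup G)⁆, zpowers c⁆ = ⊥ := by
    rw [commutator_comm, commutator_eq_bot_iff_le_centralizer, zpowers_le]
    exact centralizer_le (commutator_mono le_top le_rfl) hc
  have h3 := commutator_commutator_eq_bot_of_rotate h1 h2
  rw [commutator_comm, commutator_eq_bot_iff_le_centralizer] at h3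
  exact h3.trans (centralizer_le (Set.singleton_subset_iff.2
    (commutator_mem_commutator (mem_top b) (mem_zpowers c))))

/-- Since `G/Z` has class at most `2`, the index counts commutators with the image of `c`, all
central in `G/Z`. -/
theorem index_centralizerModCenter_le {G : Type*} [Group G] [Finite G]
    (hU : _root_.commutator G ≤ secondCenter G) (c : G) :
    (centralizerModCenter c).index ≤ Nat.card (center (G ⧸ center G)) := by
  have hc : (c : G ⧸ center G) ∈ secondCenter (G ⧸ center G) := by
    rw [mem_secondCenter]
    intro g
    induction g using QuotientGroup.induction_on with
    | H g =>
      rw [mem_centralizerModCenter]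
      exact hU (commutator_mem_commutator (mem_top g) (mem_top c))
  rw [index_centralizerModCenter, ← card_centralCommutators_of_mem_secondCenter hc]
  exact Nat.card_mono (Set.toFinite _) (centralCommutators_le_center _)

theorem index_secondCenter (G : Type*) [Group G] :
    (secondCenter G).index = (center (G ⧸ center G)).index :=
  index_comap_of_surjective _ (QuotientGroup.mk'_surjective _)

theorem relIndex_center_secondCenter (G : Type*) [Group G] [Finite G] :
    (center G).relIndex (secondCenter G) = Nat.card (center (G ⧸ center G)) := by
  have h1 := relIndex_mul_index (center_le_secondCenter G)
  have h2 := (center (G ⧸ center G)).card_mul_index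
  rw [index_secondCenter] at h1
  exact Nat.eq_of_mul_eq_mul_right (Nat.pos_of_ne_zero index_ne_zero_of_finite)
    (h1.trans h2.symm)

end Subgroup

open Subgroup in
/-- If all noncentral classes have `p ^ 2` elements and the central quotient is not abelian, then
the central quotient has order `p ^ 3`. -/
theorem card_quotient_center_eq_prime_cube {G : Type*} [Group G] [Finite G] {p : ℕ} (hp : p.Prime)
    (hG : ∀ x : G, x ∉ center G → (centralizer {x}).index = p ^ 2)
    (hab : ¬ ∀ a b : G ⧸ center G, a * b = b * a) :
    Nat.card (G ⧸ center G) = p ^ 3 := by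
  have := Fact.mk hp
  have hP := isPGroup_quotient_center_of_index_centralizer hp hG
  have : Nontrivial (G ⧸ center G) := by
    by_contra h
    rw [not_nontrivial_iff_subsingleton] at h
    exact hab fun a b => Subsingleton.elim _ _
  have := hP.center_nontrivial
  obtain ⟨v, hv, hv1⟩ := (center (G ⧸ center G)).nontrivial_iff_exists_ne_one.1 inferInstance
  obtain ⟨x, rfl⟩ := QuotientGroup.mk_surjective v
  have hxU : x ∈ secondCenter G := hv
  have hxc : x ∉ center G := mt (QuotientGroup.eq_one_iff x).2 hv1
  have hU := commutator_le_secondCenter hP hG hxU hxc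
  obtain ⟨w, hw, hwc⟩ : ∃ w ∈ _root_.commutator G, w ∉ center G := by
    by_contra! h
    refine hab fun a b => ?_
    induction a using QuotientGroup.induction_on with
    | H a =>
    induction b using QuotientGroup.induction_on with
    | H b =>
    rw [← commutatorElement_eq_one_iff_mul_comm]
    exact (QuotientGroup.eq_one_iff _).2 (h _ (commutator_mem_commutator (mem_top a) (mem_top b)))
  have hle : ∀ u ∈ secondCenter G, u ∉ center G → centralizer {u} ≤ centralizer {w} :=
    fun u hu huc => centralizer_le_centralizer_of_mem_secondCenter hp hG hU hw hwc hu huc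
  have hwtop : centralizer {w} ≠ ⊤ := mt centralizer_singleton_eq_top_iff.1 hwc
  have hcard : Nat.card (center (G ⧸ center G)) = p := by
    obtain ⟨n, hn⟩ := IsPGroup.iff_card.1 (hP.to_subgroup (center (G ⧸ center G)))
    obtain ⟨y, hy⟩ : ∃ y, y ∉ centralizer {w} := by
      by_contra! h
      exact hwtop ((eq_top_iff' _).2 h)
    have hyU : y ∉ secondCenter G := fun h =>
      hy (mem_centralizer_singleton_comm.1 (commutator_le_centralizer_of_mem_secondCenter h hw))
    have hyc : y ∉ center G := fun h => hyU (center_le_secondCenter G h)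
    have hJ := (card_centralCommutators_eq_prime hp (hG y hyc) hyU (hU hw) hy).1
    have hinf : centralizer {y} ⊓ secondCenter G ≤ center G := by
      rintro u ⟨huy, hu⟩
      by_contra huc
      exact hy (hle u hu huc (mem_centralizer_singleton_comm.1 huy))
    -- As `C(y) ∩ U ≤ Z`, the quotient `U/Z` is no larger than `M(y)/C(y)`, which has order `|J(y)|
    -- = p`.
    have hlep : Nat.card (center (G ⧸ center G)) ≤ p := by
      rw [← relIndex_center_secondCenter, ← hJ, card_centralCommutators]
      calc (center G).relIndex (secondCenter G)
          ≤ (centralizer {y} ⊓ secondCenter G).relIndex (secondCenter G) :=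
            relIndex_le_of_le_left hinf index_ne_zero_of_finite
        _ = (centralizer {y}).relIndex (secondCenter G) := inf_relIndex_right _ _
        _ ≤ (centralizer {y}).relIndex (centralizerModCenter y) := by
            refine relIndex_le_of_le_right (fun u hu => ?_) index_ne_zero_of_finite
            exact mem_centralizerModCenter_comm.1 (mem_secondCenter.1 hu y)
    have hgt : 1 < Nat.card (center (G ⧸ center G)) := Finite.one_lt_card
    rcases n with - | n
    · rw [hn, pow_zero] at hgt
      exact absurd hgt (lt_irrefl 1)
    · refine le_antisymm hlep (hn ▸ ?_)
      exact Nat.le_self_pow n.succ_ne_zero p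
  have hUw : secondCenter G = centralizer {w} := by
    refine le_antisymm (fun u hu => mem_centralizer_singleton_comm.1
      (commutator_le_centralizer_of_mem_secondCenter hu hw)) fun c hc => ?_
    rw [mem_secondCenter]
    intro b
    by_contra hbc
    rw [mem_centralizerModCenter] at hbc
    -- By maximality and equal index, all noncentral elements of `G'` share the centralizer of `w`.
    have hcc : c ∈ centralizer (_root_.commutator G : Set G) := by
      rw [mem_centralizer_iff]
      intro u hu
      by_cases huc : u ∈ center G
      · exact (mem_center_iff.1 huc c).symm
      · have heq : centralizer {u} = centralizer {w} :=
          eq_of_le_of_card_ge (hle u (hU hu) huc) (by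
            have h1 := (centralizer {u}).card_mul_index
            have h2 := (centralizer {w}).card_mul_index
            rw [hG u huc] at h1
            rw [hG w hwc] at h2
            exact (Nat.eq_of_mul_eq_mul_right (pow_pos hp.pos 2) (h2.trans h1.symm)).le)
        rw [← heq] at hc
        exact (mem_centralizer_singleton_iff.1 hc).symm
    -- A noncentral `⁅b, c⁆` would give `p ^ 2 ≤ |G : M(c)| ≤ p`.
    have h1 := index_antitone (centralizerModCenter_le_centralizer_commutatorElement (b := b) hcc)
    have h2 := index_centralizerModCenter_le hU c
    rw [hG _ hbc] at h1
    rw [hcard] at h2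
    nlinarith [hp.two_le]
  have h := (center (G ⧸ center G)).card_mul_index
  rw [hcard, ← index_secondCenter, hUw, hG w hwc] at h
  rw [← h]
  ring

/-! ### Abelian central quotient -/

namespace Subgroup

theorem eq_of_le_of_index_eq {G : Type*} [Group G] [Finite G] {H K : Subgroup G} (hle : H ≤ K)
    (h : H.index = K.index) : H = K := by
  have := relIndex_mul_index hle
  rw [h, Nat.mul_eq_right index_ne_zero_of_finite, relIndex_eq_one] at this
  exact le_antisymm hle this

/-- If all noncentral classes have `p ^ 2` elements and the central quotient is abelian, then
it has exponent dividing `p`. -/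
theorem pow_mem_center_of_commutative_quotient {G : Type*} [Group G] [Finite G] {p : ℕ}
    (hp : p.Prime) (hG : ∀ x : G, x ∉ center G → (centralizer {x}).index = p ^ 2)
    (hab : ∀ a b : G ⧸ center G, a * b = b * a) (x : G) : x ^ p ∈ center G := by
  have := Fact.mk hp
  by_contra hxp
  have hx : x ∉ center G := fun h => hxp (pow_mem h p)
  have hU : ∀ g : G, g ∈ secondCenter G := fun g => mem_center_iff.2 fun _ => hab _ _
  have heq : centralizer {x} = centralizer {x ^ p} := by
    refine eq_of_le_of_index_eq (fun g hg => ?_) ((hG x hx).trans (hG _ hxp).symm)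
    rw [mem_centralizer_singleton_iff] at hg ⊢
    exact Commute.pow_right (show Commute g x from hg) p
  have hcard : Nat.card (centralCommutators x) = p ^ 2 :=
    (card_centralCommutators_of_mem_secondCenter (hU x)).trans (hG x hx)
  obtain ⟨z, hz⟩ := exists_prime_orderOf_dvd_card' p (hcard ▸ dvd_pow_self p two_ne_zero)
  obtain ⟨-, g, hg⟩ := mem_centralCommutators.1 z.2
  have hz1 : ⁅g, x⁆ ≠ 1 := by
    rw [hg, Ne, OneMemClass.coe_eq_one, ← orderOf_eq_one_iff, hz]
    exact hp.ne_one
  have hzp : ⁅g, x⁆ ^ p = 1 := by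
    rw [hg, ← hz, ← SubmonoidClass.coe_pow, pow_orderOf_eq_one, OneMemClass.coe_one]
  have hpow : ⁅x ^ p, g⁆ = ⁅x, g⁆ ^ p :=
    map_pow (commutatorHom g) ⟨x, mem_secondCenter.1 (hU g) x⟩ p
  rw [← commutatorElement_inv g x, inv_pow, hzp, inv_one,
    ← mem_centralizer_singleton_iff_commutatorElement, mem_centralizer_singleton_comm, ← heq,
    mem_centralizer_singleton_iff_commutatorElement] at hpow
  exact hz1 hpow

/-! ### Counting centralizers when the central quotient has order `p ^ 3` -/

theorem center_le_centralizer_singleton {G : Type*} [Group G] (x : G) :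
    center G ≤ centralizer {x} := center_le_centralizer _

theorem card_map_mk'_center_centralizer {G : Type*} [Group G] [Finite G] {p : ℕ} (hp : p.Prime)
    (hcard : Nat.card (G ⧸ center G) = p ^ 3) {x : G} (hx : (centralizer {x}).index = p ^ 2) :
    Nat.card ((centralizer {x}).map (QuotientGroup.mk' (center G))) = p := by
  have h := relIndex_mul_index (center_le_centralizer_singleton x)
  rw [hx, index_eq_card, hcard, pow_succ' p 2] at h
  rw [← relIndex_ker, QuotientGroup.ker_mk']
  exact Nat.eq_of_mul_eq_mul_right (pow_pos hp.pos 2) h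

theorem mem_centralizer_iff_mk_mem_map {G : Type*} [Group G] {g x : G} :
    (g : G ⧸ center G) ∈ (centralizer {x}).map (QuotientGroup.mk' (center G)) ↔
      g ∈ centralizer {x} := by
  refine ⟨?_, fun h => mem_map_of_mem _ h⟩
  rintro ⟨c, hc, h⟩
  exact (mul_mem_cancel_left (inv_mem hc)).1
    (center_le_centralizer_singleton x (QuotientGroup.eq.1 h))

/-- Both images in `G/Z` have order `p` and contain the nontrivial image of `y`. -/
theorem centralizer_eq_of_mem_of_card {G : Type*} [Group G] [Finite G] {p : ℕ} (hp : p.Prime)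
    (hG : ∀ x : G, x ∉ center G → (centralizer {x}).index = p ^ 2)
    (hcard : Nat.card (G ⧸ center G) = p ^ 3) {x y : G} (hx : x ∉ center G) (hy : y ∉ center G)
    (hyx : y ∈ centralizer {x}) : centralizer {y} = centralizer {x} := by
  have h := eq_of_card_eq_prime_of_mem hp
    (card_map_mk'_center_centralizer hp hcard (hG y hy))
    (card_map_mk'_center_centralizer hp hcard (hG x hx))
    (mem_centralizer_iff_mk_mem_map.2 (mem_centralizer_singleton_iff.2 rfl))
    (mem_centralizer_iff_mk_mem_map.2 hyx) (mt (QuotientGroup.eq_one_iff y).1 hy)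
  ext g
  rw [← mem_centralizer_iff_mk_mem_map, h, mem_centralizer_iff_mk_mem_map]

theorem centralizer_out_mk {G : Type*} [Group G] (x : G) :
    centralizer {(x : G ⧸ center G).out} = centralizer {x} := by
  obtain ⟨z, hz⟩ := QuotientGroup.mk_out_eq_mul (center G) x
  ext g
  rw [hz, mem_centralizer_singleton_iff, mem_centralizer_singleton_iff, ← mul_assoc,
    mul_assoc x, ← mem_center_iff.1 z.2 g, ← mul_assoc, mul_left_inj]

end Subgroup

open Subgroup

/-- The fibers of `v ↦ C(v.out)` are `{1}` and the sets `C(x)/Z` without `1`, so `p ^ 3 = 1 + N * (p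
- 1)`; the extra centralizer is `G`. -/
theorem ncard_elementCentralizers {G : Type*} [Group G] [Finite G] {p : ℕ} (hp : p.Prime)
    (hG : ∀ x : G, x ∉ center G → (centralizer {x}).index = p ^ 2)
    (hcard : Nat.card (G ⧸ center G) = p ^ 3) :
    (elementCentralizers G).ncard = p ^ 2 + p + 2 := by
  classical
  have := Fintype.ofFinite (G ⧸ center G)
  let f : G ⧸ center G → Subgroup G := fun v => centralizer {v.out}
  have hf : ∀ x : G, f x = centralizer {x} := centralizer_out_mk
  have hrange : elementCentralizers G = (Finset.univ.image f : Finset (Subgroup G)) := by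
    ext H
    simp only [elementCentralizers, Set.mem_range, Finset.coe_image, Finset.coe_univ,
      Set.image_univ]
    constructor
    · rintro ⟨x, rfl⟩
      exact ⟨x, hf x⟩
    · rintro ⟨v, rfl⟩
      exact ⟨v.out, rfl⟩
  have hone : ∀ v, f v = ⊤ ↔ v = 1 := fun v => by
    induction v using QuotientGroup.induction_on with
    | H x => rw [hf, centralizer_singleton_eq_top_iff, QuotientGroup.eq_one_iff]
  have htop : (⊤ : Subgroup G) ∈ Finset.univ.image f :=
    Finset.mem_image.2 ⟨1, Finset.mem_univ _, (hone 1).2 rfl⟩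
  have hfiber_top : (Finset.univ.filter fun v => f v = ⊤).card = 1 :=
    Finset.card_eq_one.2 ⟨1, by ext; simp [hone]⟩
  have hfiber : ∀ H ∈ (Finset.univ.image f).erase ⊤,
      (Finset.univ.filter fun v => f v = H).card = p - 1 := by
    intro H hH
    obtain ⟨hHtop, hH⟩ := Finset.mem_erase.1 hH
    obtain ⟨v, -, rfl⟩ := Finset.mem_image.1 hH
    induction v using QuotientGroup.induction_on with
    | H x =>
    rw [hf] at hHtop ⊢
    have hx := mt centralizer_singleton_eq_top_iff.2 hHtop
    have hD := card_map_mk'_center_centralizer hp hcard (hG x hx)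
    set D := (centralizer {x}).map (QuotientGroup.mk' (center G)) with hDdef
    have hset : (Finset.univ.filter fun v => f v = centralizer {x}) =
        (D : Set (G ⧸ center G)).toFinset.erase 1 := by
      ext v
      rw [Finset.mem_filter, Finset.mem_erase, Set.mem_toFinset, SetLike.mem_coe]
      induction v using QuotientGroup.induction_on with
      | H y =>
      rw [hf, hDdef, mem_centralizer_iff_mk_mem_map, Ne, QuotientGroup.eq_one_iff]
      constructor
      · rintro ⟨-, h⟩
        refine ⟨fun hy => hHtop ?_, h ▸ mem_centralizer_singleton_iff.2 rfl⟩
        rw [← h, centralizer_singleton_eq_top_iff]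
        exact hy
      · rintro ⟨hy, hyx⟩
        exact ⟨Finset.mem_univ _, centralizer_eq_of_mem_of_card hp hG hcard hx hy hyx⟩
    rw [hset, Finset.card_erase_of_mem (by simp), Set.toFinset_card, ← Nat.card_eq_fintype_card]
    exact congrArg (· - 1) hD
  have hsum := Finset.card_eq_sum_card_image f Finset.univ
  rw [← Finset.add_sum_erase _ _ htop, hfiber_top, Finset.sum_congr rfl hfiber, Finset.sum_const,
    Finset.card_univ, ← Nat.card_eq_fintype_card, hcard, smul_eq_mul] at hsum
  rw [hrange, Set.ncard_coe_finset, ← Finset.card_erase_add_one htop]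
  obtain ⟨q, rfl⟩ : ∃ q, p = q + 1 := ⟨p - 1, (Nat.succ_pred_prime hp).symm⟩
  have hq : 0 < q := Nat.lt_of_succ_lt_succ hp.one_lt
  rw [Nat.add_sub_cancel] at hsum
  have hN : ((Finset.univ.image f).erase ⊤).card = (q + 1) ^ 2 + (q + 1) + 1 :=
    Nat.eq_of_mul_eq_mul_right hq (by linarith)
  rw [hN]

theorem mainTheorem8 {G : Type*} [Group G] [Finite G] (p : ℕ) (hp : p.Prime)
    (hG : ∀ x : G, x ∉ Subgroup.center G → (Subgroup.centralizer {x}).index = p ^ 2) :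
    IsElementaryAbelian p (G ⧸ Subgroup.center G) ∨
      (Odd p ∧
        (¬ ∀ a b : G ⧸ Subgroup.center G, a * b = b * a) ∧
        Nat.card (G ⧸ Subgroup.center G) = p ^ 3 ∧
        Monoid.exponent (G ⧸ Subgroup.center G) = p ∧
        (elementCentralizers G).ncard = p ^ 2 + p + 2) := by
  by_cases hab : ∀ a b : G ⧸ center G, a * b = b * a
  · refine Or.inl ⟨hab, fun v => ?_⟩
    induction v using QuotientGroup.induction_on with
    | H x =>
    exact (QuotientGroup.eq_one_iff _).2 (pow_mem_center_of_commutative_quotient hp hG hab x)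
  · have hcard := card_quotient_center_eq_prime_cube hp hG hab
    have hexp : Monoid.exponent (G ⧸ center G) = p := by
      have hdvd : Monoid.exponent (G ⧸ center G) ∣ p := by
        refine Monoid.exponent_dvd_of_forall_pow_eq_one fun v => ?_
        induction v using QuotientGroup.induction_on with
        | H x =>
        by_cases hx : x ∈ center G
        · rw [(QuotientGroup.eq_one_iff x).2 hx, one_pow]
        · have hmem : (x : G ⧸ center G) ∈
              (centralizer {x}).map (QuotientGroup.mk' (center G)) :=
            mem_centralizer_iff_mk_mem_map.2 (mem_centralizer_singleton_iff.2 rfl)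
          have hD := card_map_mk'_center_centralizer hp hcard (hG x hx)
          rw [← orderOf_dvd_iff_pow_eq_one, ← hD]
          exact orderOf_dvd_natCard _ hmem
      refine ((Nat.dvd_prime hp).1 hdvd).resolve_left fun h => hab fun a b => ?_
      have := Monoid.exp_eq_one_iff.1 h
      exact Subsingleton.elim _ _
    refine Or.inr ⟨hp.odd_of_ne_two ?_, hab, hcard, hexp, ncard_elementCentralizers hp hG hcard⟩
    rintro rfl
    exact hab (mul_comm_of_exponent_two hexp)
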